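/- Let $K$ be an ordered field (for example $\mathbb{Q}$ or $\mathbb{R}$). The diagram of a partition $\mu$ is the set of cells $(r,s)$ with $r\ge 0$ and $0\le s<\mu_{r+1}$. For a partition $\mu$ of $N$ with cells $(p_1,q_1),\dots,(p_N,q_N)$, listed in lexicographic order, let $$\Delta_\mu=\det\bigl\|x_i^{p_j}y_i^{q_j}\bigr\|_{i,j=1}^N\in K[x_1,\dots,x_N;y_1,\dots,y_N],$$ and let $\mathbf M_\mu$ be the $K$-linear span of all partial derivatives (of all orders, including $\Delta_\mu$ itself) of $\Delta_\mu$. For a polynomial $P$ let $P(\partial)$ be the differential operator obtained by replacing each $x_i$ by $\partial_{x_i}$ and each $y_i$ by $\partial_{y_i}$. Put $\langle P,Q\rangle=P(\partial)Q\,|_{x=y=0}$, let $\perp$ denote orthogonal complements for this scalar product, and call $P(\partial)\Delta$ the flip of $P$ with respect to $\Delta$. Let $\mu$ be a partition of $n+1$ with two corners: $\mu$ has $l_b$ rows of length $b$ and $l_a$ rows of length $a$, where $l_a,l_b,a>0$ and $c=b-a>0$. Let $\alpha$ and $\beta$ be the partitions of $n$ obtained from $\mu$ by removing the corner $(l_a+l_b-1,\,a-1)$,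 respectively the corner $(l_b-1,\,b-1)$. Divide the diagram of $\mu$ into $$\mathrm{UPR}=\{l_b\le r<l_b+l_a,\ 0\le s<a\},\qquad \mathrm{INS}=\{0\le r<l_b,\ 0\le s<\min(a,c)\},$$ $$\mathrm{MID}=\{0\le r<l_b,\ \min(a,c)\le s<\max(a,c)\},\qquad \mathrm{OUT}=\{0\le r<l_b,\ \max(a,c)\le s<b\}.$$ **Theorem 4.1.** Suppose that $\dim\mathbf M_\alpha=\dim\mathbf M_\beta=n!$ and $\dim(\mathbf M_\alpha\cap\mathbf M_\beta)=n!/2$. Then $\dim\mathbf M_\mu=(n+1)!$. Moreover, let $\mathcal B_A$, $\mathcal B_B$, $\mathcal B_{A\cup B}$ be any bases of $\mathbf M_\alpha$, $\mathbf M_\beta$, $\mathbf M_\alpha+\mathbf M_\beta$, and let $\mathcal B^*$ be any collection of polynomials in $x_1,\dots,x_n;y_1,\dots,y_n$ whose flips with respect to $\Delta_\beta$ form a basis of $(\mathbf M_\alpha\cap\mathbf M_\beta)^\perp\cap\mathbf M_\beta$, the orthogonal complement of $\mathbf M_\alpha\cap\mathbf M_\beta$ in $\mathbf M_\beta$. Then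 the family $$b(\partial)\,\partial_{x_{n+1}}^r\partial_{y_{n+1}}^s\Delta_\mu,\qquad (r,s)\in\mu,\ b\in\mathcal B_{r,s},$$ is a basis of $\mathbf M_\mu$, where $\mathcal B_{r,s}=\mathcal B_A$ for $(r,s)\in\mathrm{UPR}$, $\mathcal B_{r,s}=\mathcal B_{A\cup B}$ for $(r,s)\in\mathrm{INS}$, $\mathcal B_{r,s}=\mathcal B^*$ for $(r,s)\in\mathrm{OUT}$, and, for $(r,s)\in\mathrm{MID}$, $\mathcal B_{r,s}=\mathcal B_B$ if $c>a$ and $\mathcal B_{r,s}=\mathcal B_A$ if $c\le a$. -/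

import Mathlib

open MvPolynomial
open scoped Nat

/-- The polynomial ring `K[x_1,…,x_n; y_1,…,y_n]`: `X (Sum.inl i)` is `x_i` and
`X (Sum.inr i)` is `y_i`. -/
abbrev XYPoly (K : Type*) [Field K] (n : ℕ) : Type _ := MvPolynomial (Fin n ⊕ Fin n) K

/-- A family `v` is a basis of the subspace `W`. -/
def IsBasisOf {K V ι : Type*} [Field K] [AddCommGroup V] [Module K V]
    (v : ι → V) (W : Submodule K V) : Prop :=
  LinearIndependent K v ∧ Submodule.span K (Set.range v) = W

section DifferentialOperators

variable {K : Type*} [Field K]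

/-- The partial derivative with respect to one variable, as a linear operator. -/
noncomputable def partialD {σ : Type*} (i : σ) : Module.End K (MvPolynomial σ K) :=
  (pderiv i : Derivation K (MvPolynomial σ K) (MvPolynomial σ K)).toLinearMap

theorem partialD_commute {σ : Type*} (i j : σ) :
    Commute (partialD (K := K) i) (partialD j) := by
  have h : ⁅(pderiv i : Derivation K (MvPolynomial σ K) (MvPolynomial σ K)),
      (pderiv j : Derivation K (MvPolynomial σ K) (MvPolynomial σ K))⁆ = 0 := by
    classical
    refine MvPolynomial.derivation_ext fun k => ?_
    rw [Derivation.commutator_apply, pderiv_X, pderiv_X]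
    by_cases hik : i = k <;> by_cases hjk : j = k <;> simp [hik, hjk]
  refine LinearMap.ext fun p => ?_
  have h2 := congrArg (fun D => D p) h
  simp only [Derivation.commutator_apply, Derivation.coe_zero, Pi.zero_apply] at h2
  exact sub_eq_zero.mp h2

/-- The iterated partial derivative `∏ i, ∂_i ^ (m i)` attached to an exponent vector `m`. -/
noncomputable def iterD {σ : Type*} (m : σ →₀ ℕ) : Module.End K (MvPolynomial σ K) :=
  m.support.noncommProd (fun i => partialD i ^ m i)
    (fun i _ j _ _ => (partialD_commute i j).pow_pow (m i) (m j))

/-- `P(∂)`: the constant coefficient differential operator obtained from the polynomial `P` by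
replacing every variable by the corresponding partial derivative. -/
noncomputable def diffOp {σ : Type*} (P : MvPolynomial σ K) : Module.End K (MvPolynomial σ K) :=
  ∑ m ∈ P.support, P.coeff m • iterD m

/-- The scalar product `⟨P, Q⟩ = P(∂) Q |_{x = y = 0}`. -/
noncomputable def scalarProd {σ : Type*} (P Q : MvPolynomial σ K) : K :=
  constantCoeff (diffOp P Q)

/-- The orthogonal complement `W^⊥` in the whole polynomial ring, with respect to `scalarProd`. -/
noncomputable def orthCompl {σ : Type*} (W : Submodule K (MvPolynomial σ K)) :
    Submodule K (MvPolynomial σ K) where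
  carrier := {P | ∀ Q ∈ W, scalarProd Q P = 0}
  add_mem' {P P'} hP hP' Q hQ := by
    have h1 := hP Q hQ
    have h2 := hP' Q hQ
    simp only [scalarProd] at h1 h2 ⊢
    rw [map_add, map_add, h1, h2, add_zero]
  zero_mem' Q _ := by simp [scalarProd]
  smul_mem' c P hP Q hQ := by
    have h1 := hP Q hQ
    simp only [scalarProd] at h1 ⊢
    rw [map_smul, constantCoeff_smul, h1, smul_zero]

/-- The flip with respect to `Δ`, that is `P ↦ P(∂) Δ`. -/
noncomputable def flipBy {σ : Type*} (Δ P : MvPolynomial σ K) : MvPolynomial σ K :=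
  diffOp P Δ

end DifferentialOperators

/-- The cells `(p, q)` of `μ` (row `p`, column `q`, both counted from `0`; row `0` is the
longest row), that is the biexponents of `μ`, listed in lexicographic order. -/
def biexponent (μ : YoungDiagram) {n : ℕ} (h : μ.card = n) (j : Fin n) : ℕ × ℕ :=
  ofLex ((μ.cells.map toLex.toEmbedding).orderEmbOfFin ((Finset.card_map _).trans h) j)

/-- `Δ_μ = det (x_i ^ p_j * y_i ^ q_j)`, where `(p_1, q_1), …, (p_n, q_n)` are the biexponents
of the partition `μ` of `n`. -/
noncomputable def deltaPoly (K : Type*) [Field K] (μ : YoungDiagram) {n : ℕ} (h : μ.card = n) :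
    XYPoly K n :=
  Matrix.det (Matrix.of fun i j : Fin n =>
    (X (Sum.inl i) ^ (biexponent μ h j).1 * X (Sum.inr i) ^ (biexponent μ h j).2 : XYPoly K n))

/-- `M_μ`: the linear span of all the partial derivatives (of all orders) of `Δ_μ`. -/
noncomputable def derivSpan (K : Type*) [Field K] (μ : YoungDiagram) {n : ℕ} (h : μ.card = n) :
    Submodule K (XYPoly K n) :=
  Submodule.span K (Set.range fun m : Fin n ⊕ Fin n →₀ ℕ => iterD m (deltaPoly K μ h))

/-- The inclusion of `K[x_1,…,x_n; y_1,…,y_n]` in `K[x_1,…,x_{n+1}; y_1,…,y_{n+1}]`. -/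
noncomputable def addLastVars {K : Type*} [Field K] {n : ℕ} (P : XYPoly K n) : XYPoly K (n + 1) :=
  rename (Sum.map Fin.castSucc Fin.castSucc) P

/-- `b(∂) ∂_{x_{n+1}}^r ∂_{y_{n+1}}^s Δ` for `b` in the variables with indices `1,…,n` and `Δ` in
the variables with indices `1,…,n+1`. -/
noncomputable def cellDeriv {K : Type*} [Field K] {n : ℕ} (Δ : XYPoly K (n + 1))
    (p : ℕ × ℕ) (b : XYPoly K n) : XYPoly K (n + 1) :=
  diffOp (addLastVars b) ((partialD (Sum.inl (Fin.last n)) ^ p.1)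
    ((partialD (Sum.inr (Fin.last n)) ^ p.2) Δ))

/-! The four regions of the diagram with `lb` rows of length `b = a + c` (the rows `0,…,lb-1`) and
`la` rows of length `a` (the rows `lb,…,lb+la-1`). -/

def regionUPR (la lb a : ℕ) : Set (ℕ × ℕ) :=
  {p | lb ≤ p.1 ∧ p.1 < lb + la ∧ p.2 < a}

def regionINS (lb a c : ℕ) : Set (ℕ × ℕ) :=
  {p | p.1 < lb ∧ if a < c then p.2 < a else p.2 < c}

def regionMID (lb a c : ℕ) : Set (ℕ × ℕ) :=
  {p | p.1 < lb ∧ if a < c then a ≤ p.2 ∧ p.2 < c else c ≤ p.2 ∧ p.2 < a}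

def regionOUT (lb a b c : ℕ) : Set (ℕ × ℕ) :=
  {p | p.1 < lb ∧ if a < c then c ≤ p.2 ∧ p.2 < b else a ≤ p.2 ∧ p.2 < b}

/-! The proof matches an upper bound for $\dim\mathbf M_\mu$ with a count of linearly independent
elements.

Upper bound. Evaluate polynomials on the orbit of the list of cells of $\mu$ under permutation,
which has $(n+1)!$ points. The alternating sum over the orbit of a monomial of degree at most
$\deg\Delta_\mu$ is its scalar product with $\Delta_\mu$ (`sum_sign_mul_cellEval`). Hence monomials
whose derivatives of $\Delta_\mu$ are independent are also independent as functions on the orbit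
(`linearIndependent_cellEval`).

Independence. Write a relation as $\sum_p f_p(\partial)\,\partial^p\Delta_\mu=0$. Each coefficient
in the last pair of variables gives $\sum_p f_p(\partial)D_{d+p}=0$, where $D_c$ vanishes off $\mu$
and is a nonzero multiple of $\Delta_\alpha$ or $\Delta_\beta$ at the two corners. Choosing $d$ so
that a given cell lands on a corner leaves one or two unknown terms
(`forall_eq_zero_of_cell_relations`). An element of $\mathbf M_\alpha+\mathbf M_\beta$ that kills
both determinants is orthogonal to itself, hence zero; when two terms survive, orthogonality to
$\mathbf M_\alpha\cap\mathbf M_\beta$ separates them.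

Count. With $k=n!/2$ the bases have at least $2k$, $3k$, $2k$, $k$ elements on UPR, INS, MID, OUT.
This averages to $2k=n!$ per cell, so the family has at least $(n+1)!$ members. -/

/-! ### The algebra of constant coefficient operators -/

section DiffOpAlgebra

variable {K : Type*} [Field K] {σ : Type*}

open scoped IsMulCommutative in
/-- `P ↦ P(∂)` is a homomorphism of algebras. -/
theorem exists_algHom_eq_diffOp :
    ∃ F : MvPolynomial σ K →ₐ[K] Module.End K (MvPolynomial σ K),
      (∀ P, F P = diffOp P) ∧ (∀ m, iterD m = F (monomial m 1)) ∧ ∀ i, F (X i) = partialD i := by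
  classical
  -- `aeval` needs a commutative target, so it is taken in the subalgebra generated by the commuting
  -- partial derivatives.
  let s : Set (Module.End K (MvPolynomial σ K)) := Set.range partialD
  have hs : ∀ a ∈ s, ∀ b ∈ s, a * b = b * a := by
    rintro _ ⟨i, rfl⟩ _ ⟨j, rfl⟩
    exact partialD_commute i j
  have := Algebra.isMulCommutative_adjoin K hs
  let D : σ → Algebra.adjoin K s := fun i => ⟨partialD i, Algebra.subset_adjoin ⟨i, rfl⟩⟩
  let F : MvPolynomial σ K →ₐ[K] Module.End K (MvPolynomial σ K) :=
    (Algebra.adjoin K s).val.comp (aeval D)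
  have hiter : ∀ m, iterD m = F (monomial m 1) := by
    intro m
    have h1 : F (monomial m 1) = (Algebra.adjoin K s).val (∏ i ∈ m.support, D i ^ m i) := by
      simp [F, aeval_monomial, Finsupp.prod]
    rw [h1, ← Finset.noncommProd_eq_prod]
    exact (Finset.map_noncommProd m.support (fun i => D i ^ m i) _ (Algebra.adjoin K s).val).symm
  refine ⟨F, fun P => ?_, hiter, fun i => by simp [F, D]⟩
  conv_lhs => rw [P.as_sum]
  rw [map_sum, diffOp]
  refine Finset.sum_congr rfl fun m _ => ?_
  rw [hiter, ← map_smul, smul_monomial, smul_eq_mul, mul_one]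

/-- `P ↦ P(∂)` as a homomorphism of algebras. -/
noncomputable def diffOpHom : MvPolynomial σ K →ₐ[K] Module.End K (MvPolynomial σ K) :=
  exists_algHom_eq_diffOp.choose

theorem diffOpHom_apply (P : MvPolynomial σ K) : diffOpHom P = diffOp P :=
  exists_algHom_eq_diffOp.choose_spec.1 P

theorem iterD_eq_diffOp (m : σ →₀ ℕ) : iterD (K := K) m = diffOp (monomial m 1) := by
  rw [← diffOpHom_apply]
  exact exists_algHom_eq_diffOp.choose_spec.2.1 m

theorem diffOp_X (i : σ) : diffOp (X i : MvPolynomial σ K) = partialD i := by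
  rw [← diffOpHom_apply]
  exact exists_algHom_eq_diffOp.choose_spec.2.2 i

theorem diffOp_mul (P Q : MvPolynomial σ K) : diffOp (P * Q) = diffOp P * diffOp Q := by
  simp only [← diffOpHom_apply, map_mul]

theorem diffOp_add (P Q : MvPolynomial σ K) : diffOp (P + Q) = diffOp P + diffOp Q := by
  simp only [← diffOpHom_apply, map_add]

theorem diffOp_C (a : K) : diffOp (C a : MvPolynomial σ K) = a • 1 := by
  rw [← diffOpHom_apply, ← algebraMap_eq, AlgHom.commutes, Algebra.algebraMap_eq_smul_one]

theorem diffOp_comm_apply (P Q R : MvPolynomial σ K) :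
    diffOp P (diffOp Q R) = diffOp Q (diffOp P R) := by
  rw [← Module.End.mul_apply, ← diffOp_mul, mul_comm, diffOp_mul, Module.End.mul_apply]

/-- `P ↦ P(∂) Δ` as a linear map. -/
noncomputable def flipLin (Δ : MvPolynomial σ K) : MvPolynomial σ K →ₗ[K] MvPolynomial σ K :=
  (LinearMap.applyₗ Δ).comp diffOpHom.toLinearMap

theorem flipLin_apply (Δ P : MvPolynomial σ K) : flipLin Δ P = diffOp P Δ := by
  simp [flipLin, diffOpHom_apply]

theorem span_range_iterD (Δ : MvPolynomial σ K) :
    Submodule.span K (Set.range fun m : σ →₀ ℕ => iterD m Δ) = LinearMap.range (flipLin Δ) := by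
  have h : (fun m : σ →₀ ℕ => iterD m Δ) = flipLin Δ ∘ basisMonomials σ K := by
    funext m
    simp [flipLin_apply, iterD_eq_diffOp]
  rw [h, Set.range_comp, ← Submodule.map_span, (basisMonomials σ K).span_eq,
    Submodule.map_top]

end DiffOpAlgebra

/-! ### Positivity of the scalar product -/

section ScalarProduct

variable {K : Type*} [Field K] {σ : Type*} [Fintype σ]

/-- The product of the factorials of the exponents. -/
def multiFactorial (m : σ →₀ ℕ) : ℕ := ∏ i, (m i)!

theorem multiFactorial_add_single (m : σ →₀ ℕ) (i : σ) :
    multiFactorial (m + Finsupp.single i 1) = (m i + 1) * multiFactorial m := by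
  classical
  have h : ∀ j, ((m + Finsupp.single i 1 : σ →₀ ℕ) j)! = (if i = j then m j + 1 else 1) * (m j)! := by
    intro j
    by_cases hij : i = j
    · subst hij; simp [Nat.factorial_succ]
    · simp [hij]
  simp only [multiFactorial, h, Finset.prod_mul_distrib, Finset.prod_ite_eq, Finset.mem_univ, if_true]

/-- Weighting coefficients by factorials turns differentiation into a pure shift of exponents, with
no division. -/
theorem coeff_iterD (m : σ →₀ ℕ) : ∀ (j : σ →₀ ℕ) (Q : MvPolynomial σ K),
    (multiFactorial j : K) * coeff j (iterD m Q) = multiFactorial (j + m) * coeff (j + m) Q := by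
  have hadd : ∀ m m' : σ →₀ ℕ, iterD (K := K) (m + m') = iterD m * iterD m' := by
    intro m m'
    rw [iterD_eq_diffOp, iterD_eq_diffOp, iterD_eq_diffOp, ← diffOp_mul, monomial_mul, one_mul]
  induction m using Finsupp.induction_linear with
  | zero =>
    intro j Q
    have : iterD (K := K) (0 : σ →₀ ℕ) = 1 := by simp [iterD]
    simp [this]
  | add f g hf hg =>
    intro j Q
    rw [hadd, Module.End.mul_apply, hf, hg, add_assoc]
  | single i k =>
    induction k with
    | zero =>
      intro j Q
      have : iterD (K := K) (0 : σ →₀ ℕ) = 1 := by simp [iterD]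
      simp [this]
    | succ k ih =>
      intro j Q
      have h1 : iterD (K := K) (Finsupp.single i 1) = partialD i := by
        rw [iterD_eq_diffOp, ← diffOp_X]; rfl
      rw [Finsupp.single_add, hadd, Module.End.mul_apply, ih, ← add_assoc, h1, partialD]
      rw [multiFactorial_add_single]
      have h2 := coeff_pderiv (R := K) (i := i) Q (j + Finsupp.single i k)
      rw [Derivation.coeFn_coe, h2]
      push_cast
      ring

theorem scalarProd_monomial (m : σ →₀ ℕ) (Q : MvPolynomial σ K) :
    scalarProd (monomial m 1) Q = multiFactorial m * coeff m Q := by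
  have := coeff_iterD m 0 Q
  rw [zero_add] at this
  rw [scalarProd, ← iterD_eq_diffOp, ← this]
  simp [multiFactorial, constantCoeff_eq]

theorem scalarProd_eq_sum (P Q : MvPolynomial σ K) :
    scalarProd P Q = ∑ m ∈ P.support, coeff m P * (multiFactorial m * coeff m Q) := by
  rw [scalarProd, diffOp, LinearMap.sum_apply, map_sum]
  refine Finset.sum_congr rfl fun m _ => ?_
  rw [LinearMap.smul_apply, constantCoeff_smul, iterD_eq_diffOp, ← scalarProd_monomial,
    scalarProd, smul_eq_mul]

theorem eq_zero_of_scalarProd_monomial [CharZero K] {Q : MvPolynomial σ K}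
    (h : ∀ m : σ →₀ ℕ, scalarProd (monomial m 1) Q = 0) : Q = 0 := by
  ext m
  have h1 := h m
  rw [scalarProd_monomial] at h1
  have h2 : (multiFactorial m : K) ≠ 0 :=
    Nat.cast_ne_zero.2 (Finset.prod_ne_zero_iff.2 fun i _ => Nat.factorial_ne_zero _)
  simpa [h2] using h1

/-- Monomials are orthogonal with positive norms, so $\langle P,P\rangle$ is a positively weighted
sum of squares. Apart from characteristic zero, this is all that is used of the order on $K$. -/
theorem eq_zero_of_scalarProd_self [LinearOrder K] [IsStrictOrderedRing K] {P : MvPolynomial σ K}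
    (h : scalarProd P P = 0) : P = 0 := by
  rw [scalarProd_eq_sum, Finset.sum_eq_zero_iff_of_nonneg] at h
  · ext m
    by_contra hm
    rw [coeff_zero] at hm
    have h1 := h m (mem_support_iff.2 hm)
    have h2 : (multiFactorial m : K) ≠ 0 :=
      Nat.cast_ne_zero.2 (Finset.prod_ne_zero_iff.2 fun i _ => Nat.factorial_ne_zero _)
    simp [hm, h2] at h1
  · intro m _
    rw [mul_left_comm]
    exact mul_nonneg (Nat.cast_nonneg _) (mul_self_nonneg _)

/-- A polynomial killed by `Δ₁` and `Δ₂` is orthogonal to all the derivatives of `Δ₁` and `Δ₂`. -/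
theorem eq_zero_of_flip_eq_zero [LinearOrder K] [IsStrictOrderedRing K]
    {Δ₁ Δ₂ P : MvPolynomial σ K} (h₁ : diffOp P Δ₁ = 0) (h₂ : diffOp P Δ₂ = 0)
    (hP : P ∈ LinearMap.range (flipLin Δ₁) ⊔ LinearMap.range (flipLin Δ₂)) : P = 0 := by
  obtain ⟨_, ⟨Q₁, rfl⟩, _, ⟨Q₂, rfl⟩, hQ⟩ := Submodule.mem_sup.1 hP
  apply eq_zero_of_scalarProd_self
  have : diffOp P P = 0 := by
    conv_lhs => arg 2; rw [← hQ]
    rw [map_add, flipLin_apply, flipLin_apply, diffOp_comm_apply, h₁, diffOp_comm_apply, h₂]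
    simp
  rw [scalarProd, this, map_zero]

theorem eq_zero_of_mem_orthCompl [LinearOrder K] [IsStrictOrderedRing K]
    {W : Submodule K (MvPolynomial σ K)} {P : MvPolynomial σ K}
    (h : P ∈ orthCompl W) (hP : P ∈ W) : P = 0 :=
  eq_zero_of_scalarProd_self (h P hP)

end ScalarProduct

/-! ### The upper bound $n!$ by evaluation on an orbit -/

section UpperBound

theorem Nat.pow_eq_sum_stirlingSecond_mul_descFactorial (x r : ℕ) :
    x ^ r = ∑ p ∈ Finset.range (r + 1), r.stirlingSecond p * x.descFactorial p := by
  induction r with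
  | zero => simp
  | succ r ih =>
    have hx : ∀ p, x * x.descFactorial p = p * x.descFactorial p + x.descFactorial (p + 1) := by
      intro p
      rw [Nat.descFactorial_succ, ← add_mul]
      rcases le_or_gt p x with h | h
      · rw [Nat.add_sub_cancel' h]
      · rw [Nat.descFactorial_of_lt h]; simp
    -- Index shift: the term $p=0$ has factor $0$ on the left, and the term $p=r$ on the right
    -- contains $S(r,r+1)=0$.
    have h2 : ∑ p ∈ Finset.range (r + 1), r.stirlingSecond p * (p * x.descFactorial p) =
        ∑ p ∈ Finset.range (r + 1),
          (p + 1) * r.stirlingSecond (p + 1) * x.descFactorial (p + 1) := by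
      rw [Finset.sum_range_succ', Finset.sum_range_succ _ r,
        Nat.stirlingSecond_eq_zero_of_lt (Nat.lt_succ_self r)]
      simp only [zero_mul, mul_zero, add_zero]
      exact Finset.sum_congr rfl fun p _ => by ring
    rw [pow_succ, mul_comm, ih, Finset.mul_sum, Finset.sum_range_succ' _ (r + 1), Nat.stirlingSecond_succ_zero,
      zero_mul, add_zero]
    have h3 : ∀ p, x * (r.stirlingSecond p * x.descFactorial p) =
        r.stirlingSecond p * (p * x.descFactorial p) +
          r.stirlingSecond p * x.descFactorial (p + 1) := by
      intro p
      rw [mul_left_comm, hx, mul_add]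
    rw [Finset.sum_congr rfl fun p _ => h3 p, Finset.sum_add_distrib, h2, ← Finset.sum_add_distrib]
    refine Finset.sum_congr rfl fun p _ => ?_
    rw [Nat.stirlingSecond_succ_succ]
    ring

variable {N : ℕ}

/-- The total degree of an exponent vector. -/
def xyDegree (m : Fin N ⊕ Fin N →₀ ℕ) : ℕ := ∑ i, (m (Sum.inl i) + m (Sum.inr i))

theorem xyDegree_add (m m' : Fin N ⊕ Fin N →₀ ℕ) :
    xyDegree (m + m') = xyDegree m + xyDegree m' := by
  simp only [xyDegree, Finsupp.add_apply, ← Finset.sum_add_distrib]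
  exact Finset.sum_congr rfl fun i _ => by ring

/-- The exponent vector of the monomial `∏ x_i ^ p_{τ i} y_i ^ q_{τ i}`. -/
noncomputable def permExponent (e : Fin N → ℕ × ℕ) (τ : Equiv.Perm (Fin N)) : Fin N ⊕ Fin N →₀ ℕ :=
  Finsupp.equivFunOnFinite.symm (Sum.elim (fun i => (e (τ i)).1) (fun i => (e (τ i)).2))

/-- The lattice determinant `det (x_i ^ p_j * y_i ^ q_j)` of a list of cells. -/
noncomputable def latticeDet (K : Type*) [Field K] (e : Fin N → ℕ × ℕ) : XYPoly K N :=
  Matrix.det (Matrix.of fun i j : Fin N =>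
    (X (Sum.inl i) ^ (e j).1 * X (Sum.inr i) ^ (e j).2 : XYPoly K N))

variable {K : Type*} [Field K]

theorem latticeDet_eq_sum (e : Fin N → ℕ × ℕ) :
    latticeDet K e = ∑ τ : Equiv.Perm (Fin N),
      (((Equiv.Perm.sign τ : ℤ) : K)) • monomial (permExponent e τ) (1 : K) := by
  rw [latticeDet, ← Matrix.det_transpose, Matrix.det_apply']
  refine Finset.sum_congr rfl fun τ _ => ?_
  rw [monomial_eq, Finsupp.prod_fintype _ _ (fun i => by simp), Fintype.prod_sum_type,
    ← Finset.prod_mul_distrib]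
  simp [permExponent, smul_eq_C_mul]

theorem coeff_latticeDet (e : Fin N → ℕ × ℕ) (m : Fin N ⊕ Fin N →₀ ℕ) :
    coeff m (latticeDet K e) = ∑ τ : Equiv.Perm (Fin N),
      ((Equiv.Perm.sign τ : ℤ) : K) * if permExponent e τ = m then 1 else 0 := by
  classical
  rw [latticeDet_eq_sum, coeff_sum]
  refine Finset.sum_congr rfl fun τ _ => ?_
  rw [coeff_smul, coeff_monomial, smul_eq_mul]

theorem xyDegree_permExponent (e : Fin N → ℕ × ℕ) (τ : Equiv.Perm (Fin N)) :
    xyDegree (permExponent e τ) = ∑ i, ((e i).1 + (e i).2) := by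
  simpa [xyDegree, permExponent] using Equiv.sum_comp τ fun i => (e i).1 + (e i).2

theorem multiFactorial_permExponent (e : Fin N → ℕ × ℕ) (τ : Equiv.Perm (Fin N)) :
    multiFactorial (permExponent e τ) = ∏ i, ((e i).1 ! * (e i).2 !) := by
  rw [multiFactorial, Fintype.prod_sum_type, ← Finset.prod_mul_distrib]
  simpa [permExponent] using Equiv.prod_comp τ fun i => (e i).1 ! * (e i).2 !

/-- The value of the monomial with exponents `m` at the point whose `i`-th coordinate pair is the
cell `e (τ i)`. -/
def cellEval (K : Type*) [Field K] (e : Fin N → ℕ × ℕ) (m : Fin N ⊕ Fin N →₀ ℕ)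
    (τ : Equiv.Perm (Fin N)) : K :=
  ∏ i, (((e (τ i)).1 : K) ^ m (Sum.inl i) * ((e (τ i)).2 : K) ^ m (Sum.inr i))

theorem cellEval_add (e : Fin N → ℕ × ℕ) (m m' : Fin N ⊕ Fin N →₀ ℕ) (τ : Equiv.Perm (Fin N)) :
    cellEval K e (m + m') τ = cellEval K e m τ * cellEval K e m' τ := by
  rw [cellEval, cellEval, cellEval, ← Finset.prod_mul_distrib]
  refine Finset.prod_congr rfl fun i _ => ?_
  rw [Finsupp.add_apply, Finsupp.add_apply, pow_add, pow_add]
  ring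

/-- Expand both powers in falling factorials. At the point `e j` only pairs below `e j` contribute,
and these are cells because the diagram is closed downwards. -/
theorem pow_mul_pow_eq_sum_cells {e : Fin N → ℕ × ℕ} (hinj : Function.Injective e)
    (hlow : ∀ j p q, p ≤ (e j).1 → q ≤ (e j).2 → ∃ k, e k = (p, q)) (j : Fin N) (r s : ℕ) :
    (e j).1 ^ r * (e j).2 ^ s = ∑ k, r.stirlingSecond (e k).1 * s.stirlingSecond (e k).2 *
      ((e j).1.descFactorial (e k).1 * (e j).2.descFactorial (e k).2) := by
  classical
  let f : ℕ × ℕ → ℕ := fun c => r.stirlingSecond c.1 * s.stirlingSecond c.2 *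
      ((e j).1.descFactorial c.1 * (e j).2.descFactorial c.2)
  have h1 : ∑ k, f (e k) = ∑ c ∈ Finset.univ.image e, f c := by
    rw [Finset.sum_image fun _ _ _ _ h => hinj h]
  have h2 : (e j).1 ^ r * (e j).2 ^ s =
      ∑ c ∈ Finset.range (r + 1) ×ˢ Finset.range (s + 1), f c := by
    rw [Nat.pow_eq_sum_stirlingSecond_mul_descFactorial, Finset.sum_product,
      Nat.pow_eq_sum_stirlingSecond_mul_descFactorial, Finset.sum_mul_sum]
    exact Finset.sum_congr rfl fun p _ => Finset.sum_congr rfl fun q _ => by simp only [f]; ring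
  rw [h2]
  change _ = ∑ k, f (e k)
  rw [h1]
  refine Finset.sum_congr_of_eq_on_inter ?_ ?_ fun _ _ _ => rfl
  · rintro ⟨p, q⟩ - hc
    have : ¬ (p ≤ (e j).1 ∧ q ≤ (e j).2) := fun h => hc (by
      obtain ⟨k, hk⟩ := hlow j p q h.1 h.2
      exact Finset.mem_image.2 ⟨k, Finset.mem_univ _, hk⟩)
    rw [not_and_or, not_le, not_le] at this
    rcases this with h | h <;> simp [f, Nat.descFactorial_of_lt h]
  · rintro ⟨p, q⟩ - hc
    rw [Finset.mem_product, Finset.mem_range, Finset.mem_range, not_and_or, not_lt, not_lt] at hc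
    rcases hc with h | h <;> simp [f, Nat.stirlingSecond_eq_zero_of_lt (Nat.lt_of_succ_le h)]

/-- A nonzero entry requires `e k ≤ e j` componentwise, hence lexicographically, so the matrix is
triangular. -/
theorem det_descFactorial_cells {e : Fin N → ℕ × ℕ} (hmono : StrictMono fun k => toLex (e k)) :
    Matrix.det (Matrix.of fun k j : Fin N =>
      ((((e j).1.descFactorial (e k).1 * (e j).2.descFactorial (e k).2 : ℕ)) : K)) =
      (∏ i, ((e i).1 ! * (e i).2 !) : ℕ) := by
  rw [Matrix.det_of_isUpperTriangular]
  · simp [Nat.descFactorial_self]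
  · intro k j hjk
    have h1 : toLex (e j) < toLex (e k) := hmono hjk
    have h2 : ¬ ((e k).1 ≤ (e j).1 ∧ (e k).2 ≤ (e j).2) := fun h =>
      not_lt_of_ge (Prod.Lex.toLex_mono (Prod.mk_le_mk.2 h)) h1
    rw [not_and_or, not_le, not_le] at h2
    rcases h2 with h | h <;> simp [Nat.descFactorial_of_lt h]

/-- A nonzero product forces every exponent of `m` to be at least that of the permuted cell; the
degree bound then forces equality throughout, where $S(p,p)=1$. -/
theorem prod_stirlingSecond_cells {e : Fin N → ℕ × ℕ} {m : Fin N ⊕ Fin N →₀ ℕ}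
    (hm : xyDegree m ≤ ∑ i, ((e i).1 + (e i).2)) (τ : Equiv.Perm (Fin N)) :
    ∏ i, (m (Sum.inl i)).stirlingSecond (e (τ i)).1 * (m (Sum.inr i)).stirlingSecond (e (τ i)).2 =
      if permExponent e τ = m then 1 else 0 := by
  split_ifs with h
  · subst h
    simp [permExponent, Nat.stirlingSecond_self]
  · by_contra hne
    rw [← ne_eq, Finset.prod_ne_zero_iff] at hne
    have hle : ∀ i, (e (τ i)).1 ≤ m (Sum.inl i) ∧ (e (τ i)).2 ≤ m (Sum.inr i) := by
      intro i
      have := hne i (Finset.mem_univ _)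
      constructor
      · by_contra hlt
        exact this (by rw [Nat.stirlingSecond_eq_zero_of_lt (not_le.1 hlt), zero_mul])
      · by_contra hlt
        exact this (by rw [Nat.stirlingSecond_eq_zero_of_lt (not_le.1 hlt), mul_zero])
    have hsum : ∑ i, ((e (τ i)).1 + (e (τ i)).2) = ∑ i, (m (Sum.inl i) + m (Sum.inr i)) := by
      refine le_antisymm (Finset.sum_le_sum fun i _ => add_le_add (hle i).1 (hle i).2) ?_
      rw [Equiv.sum_comp τ fun i => (e i).1 + (e i).2]
      exact hm
    have heq := (Finset.sum_eq_sum_iff_of_le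
      fun i _ => add_le_add (hle i).1 (hle i).2).1 hsum
    refine h (Finsupp.ext fun i => ?_)
    rcases i with i | i
    · have h1 := heq i (Finset.mem_univ _)
      have h2 := hle i
      simp only [permExponent, Finsupp.equivFunOnFinite_symm_apply_apply, Sum.elim_inl]
      omega
    · have h1 := heq i (Finset.mem_univ _)
      have h2 := hle i
      simp only [permExponent, Finsupp.equivFunOnFinite_symm_apply_apply, Sum.elim_inr]
      omega

/-- The left side is the determinant of the evaluation matrix, which factors as Stirling numbers
times falling factorials. Up to the top degree, the first determinant is the coefficient of `m` in
the lattice determinant; the second supplies the factorials of the scalar product. -/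
theorem sum_sign_mul_cellEval {e : Fin N → ℕ × ℕ} (hmono : StrictMono fun k => toLex (e k))
    (hlow : ∀ j p q, p ≤ (e j).1 → q ≤ (e j).2 → ∃ k, e k = (p, q))
    {m : Fin N ⊕ Fin N →₀ ℕ} (hm : xyDegree m ≤ ∑ i, ((e i).1 + (e i).2)) :
    ∑ τ : Equiv.Perm (Fin N), ((Equiv.Perm.sign τ : ℤ) : K) * cellEval K e m τ =
      scalarProd (monomial m 1) (latticeDet K e) := by
  have hinj : Function.Injective e := fun i j h => hmono.injective (congrArg toLex h)
  let A : Matrix (Fin N) (Fin N) K := Matrix.of fun i k =>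
    (((m (Sum.inl i)).stirlingSecond (e k).1 * (m (Sum.inr i)).stirlingSecond (e k).2 : ℕ) : K)
  let E : Matrix (Fin N) (Fin N) K := Matrix.of fun k j =>
    (((e j).1.descFactorial (e k).1 * (e j).2.descFactorial (e k).2 : ℕ) : K)
  have hAE : A * E = Matrix.of fun i j =>
      ((e j).1 : K) ^ m (Sum.inl i) * ((e j).2 : K) ^ m (Sum.inr i) := by
    ext i j
    rw [Matrix.mul_apply]
    simp only [A, E, Matrix.of_apply]
    have h := congrArg (Nat.cast (R := K))
      (pow_mul_pow_eq_sum_cells hinj hlow j (m (Sum.inl i)) (m (Sum.inr i))).symm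
    push_cast at h ⊢
    exact h
  have h1 : ∑ τ : Equiv.Perm (Fin N), ((Equiv.Perm.sign τ : ℤ) : K) * cellEval K e m τ =
      (A * E).det := by
    rw [hAE, ← Matrix.det_transpose, Matrix.det_apply']
    rfl
  have h2 : A.det = coeff m (latticeDet K e) := by
    rw [coeff_latticeDet, ← Matrix.det_transpose, Matrix.det_apply']
    refine Finset.sum_congr rfl fun τ _ => ?_
    congr 1
    have := prod_stirlingSecond_cells hm τ
    simp only [A, Matrix.transpose_apply, Matrix.of_apply]
    rw [← Nat.cast_prod, this]
    split_ifs <;> simp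
  rw [h1, Matrix.det_mul, det_descFactorial_cells hmono, h2, scalarProd_monomial, coeff_latticeDet,
    mul_comm, Finset.mul_sum, Finset.mul_sum]
  refine Finset.sum_congr rfl fun τ _ => ?_
  split_ifs with h
  · rw [← h, multiFactorial_permExponent]
  · simp

theorem scalarProd_latticeDet_of_degree_ne (e : Fin N → ℕ × ℕ) {m : Fin N ⊕ Fin N →₀ ℕ}
    (hm : xyDegree m ≠ ∑ i, ((e i).1 + (e i).2)) :
    scalarProd (monomial m 1) (latticeDet K e) = 0 := by
  rw [scalarProd_monomial, coeff_latticeDet, Finset.sum_eq_zero, mul_zero]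
  intro τ _
  rw [if_neg, mul_zero]
  rintro rfl
  exact hm (xyDegree_permExponent e τ)

theorem scalarProd_iterD (q m : Fin N ⊕ Fin N →₀ ℕ) (Q : XYPoly K N) :
    scalarProd (monomial q 1) (iterD m Q) = scalarProd (monomial (q + m) 1) Q := by
  rw [scalarProd, scalarProd, iterD_eq_diffOp, ← Module.End.mul_apply, ← diffOp_mul, monomial_mul,
    one_mul]

/-- The top-degree part of a relation between evaluations is a relation between derivatives:
multiply by a monomial of complementary degree and take the alternating sum over the orbit. Terms of
lower degree then pair to zero with the determinant. -/
theorem linearIndependent_cellEval [CharZero K] {e : Fin N → ℕ × ℕ}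
    (hmono : StrictMono fun k => toLex (e k))
    (hlow : ∀ j p q, p ≤ (e j).1 → q ≤ (e j).2 → ∃ k, e k = (p, q))
    {ι : Type*} {g : ι → Fin N ⊕ Fin N →₀ ℕ}
    (hg : LinearIndependent K fun i => iterD (g i) (latticeDet K e)) :
    LinearIndependent K fun i => cellEval K e (g i) := by
  classical
  rw [linearIndependent_iff'] at hg ⊢
  intro s c hc
  by_contra! hne
  have hS : (s.filter fun i => c i ≠ 0).Nonempty := by
    obtain ⟨i, his, hi⟩ := hne
    exact ⟨i, Finset.mem_filter.2 ⟨his, hi⟩⟩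
  obtain ⟨i₀, hi₀, hmax⟩ := Finset.exists_max_image _ (fun i => xyDegree (g i)) hS
  rw [Finset.mem_filter] at hi₀
  set T := s.filter fun i => xyDegree (g i) = xyDegree (g i₀) with hT
  refine hi₀.2 (hg T c ?_ i₀ (Finset.mem_filter.2 ⟨hi₀.1, rfl⟩))
  refine eq_zero_of_scalarProd_monomial fun q => ?_
  have hexp : scalarProd (monomial q 1) (∑ i ∈ T, c i • iterD (g i) (latticeDet K e)) =
      ∑ i ∈ T, c i * scalarProd (monomial (q + g i) 1) (latticeDet K e) := by
    simp only [← scalarProd_iterD]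
    simp only [scalarProd, map_sum, map_smul, constantCoeff_smul, smul_eq_mul]
  rw [hexp]
  by_cases hq : xyDegree q + xyDegree (g i₀) = ∑ i, ((e i).1 + (e i).2)
  · have h1 : ∀ i ∈ s, c i * ∑ τ : Equiv.Perm (Fin N),
        ((Equiv.Perm.sign τ : ℤ) : K) * cellEval K e (q + g i) τ =
        if xyDegree (g i) = xyDegree (g i₀) then
          c i * scalarProd (monomial (q + g i) 1) (latticeDet K e) else 0 := by
      intro i his
      by_cases hci : c i = 0
      · simp [hci]
      have hle := hmax i (Finset.mem_filter.2 ⟨his, hci⟩)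
      rw [sum_sign_mul_cellEval hmono hlow (by rw [xyDegree_add]; omega)]
      split_ifs with h
      · rfl
      · rw [scalarProd_latticeDet_of_degree_ne, mul_zero]
        rw [xyDegree_add]
        omega
    rw [hT, Finset.sum_filter, ← Finset.sum_congr rfl h1]
    simp only [Finset.mul_sum]
    rw [Finset.sum_comm]
    refine Finset.sum_eq_zero fun τ _ => ?_
    have h2 := congrFun hc τ
    simp only [Finset.sum_apply, Pi.smul_apply, Pi.zero_apply, smul_eq_mul] at h2
    rw [Finset.sum_congr rfl fun i _ => show c i * (((Equiv.Perm.sign τ : ℤ) : K) *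
      cellEval K e (q + g i) τ) = (((Equiv.Perm.sign τ : ℤ) : K) * cellEval K e q τ) *
        (c i * cellEval K e (g i) τ) by rw [cellEval_add]; ring, ← Finset.mul_sum, h2, mul_zero]
  · refine Finset.sum_eq_zero fun i hi => ?_
    rw [hT, Finset.mem_filter] at hi
    rw [scalarProd_latticeDet_of_degree_ne, mul_zero]
    rw [xyDegree_add, hi.2]
    exact hq

theorem toLex_biexponent (μ : YoungDiagram) {n : ℕ} (h : μ.card = n) (j : Fin n) :
    toLex (biexponent μ h j) =
      (μ.cells.map toLex.toEmbedding).orderEmbOfFin ((Finset.card_map _).trans h) j := rfl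

theorem strictMono_biexponent (μ : YoungDiagram) {n : ℕ} (h : μ.card = n) :
    StrictMono fun k => toLex (biexponent μ h k) :=
  ((μ.cells.map toLex.toEmbedding).orderEmbOfFin ((Finset.card_map _).trans h)).strictMono

theorem biexponent_mem (μ : YoungDiagram) {n : ℕ} (h : μ.card = n) (j : Fin n) :
    biexponent μ h j ∈ μ.cells := by
  have := Finset.orderEmbOfFin_mem (μ.cells.map toLex.toEmbedding) ((Finset.card_map _).trans h) j
  rw [← toLex_biexponent] at this
  simpa using this

theorem exists_biexponent_eq (μ : YoungDiagram) {n : ℕ} (h : μ.card = n) {c : ℕ × ℕ}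
    (hc : c ∈ μ.cells) : ∃ j, biexponent μ h j = c := by
  have h1 : toLex c ∈ μ.cells.map toLex.toEmbedding := by simpa using hc
  rw [← Finset.mem_coe,
    ← Finset.range_orderEmbOfFin (μ.cells.map toLex.toEmbedding) ((Finset.card_map _).trans h)] at h1
  obtain ⟨j, hj⟩ := h1
  exact ⟨j, toLex.injective hj⟩

theorem deltaPoly_eq_latticeDet (μ : YoungDiagram) {n : ℕ} (h : μ.card = n) :
    deltaPoly K μ h = latticeDet K (biexponent μ h) := rfl

theorem derivSpan_eq_range (μ : YoungDiagram) {n : ℕ} (h : μ.card = n) :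
    derivSpan K μ h = LinearMap.range (flipLin (deltaPoly K μ h)) :=
  span_range_iterD _

/-- The `n!` upper bound of Garsia and Haiman. -/
theorem finite_and_finrank_derivSpan_le [CharZero K] (μ : YoungDiagram) {n : ℕ} (h : μ.card = n) :
    Module.Finite K (derivSpan K μ h) ∧ Module.finrank K (derivSpan K μ h) ≤ n ! := by
  -- An independent spanning subfamily of derivatives is transported to functions on the symmetric
  -- group, a space of dimension `n !`.
  obtain ⟨κ, a, -, hspan, hind⟩ :=
    exists_linearIndependent' K fun m : Fin n ⊕ Fin n →₀ ℕ => iterD m (deltaPoly K μ h)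
  have hev := linearIndependent_cellEval (strictMono_biexponent μ h)
    (fun j p q hp hq => exists_biexponent_eq μ h
      (μ.isLowerSet (show (p, q) ≤ biexponent μ h j from ⟨hp, hq⟩) (biexponent_mem μ h j))) hind
  have : Finite κ := hev.finite
  have : Fintype κ := Fintype.ofFinite κ
  have hcard := hev.fintype_card_le_finrank
  rw [Module.finrank_fintype_fun_eq_card, Fintype.card_perm, Fintype.card_fin] at hcard
  rw [derivSpan, ← hspan]
  exact ⟨FiniteDimensional.span_of_finite K (Set.finite_range _),
    (finrank_span_eq_card hind).trans_le hcard⟩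

end UpperBound

/-! ### Coefficients in the last pair of variables -/

section Slices

variable {K : Type*} [Field K]

theorem partialD_pow_eq_diffOp {σ : Type*} (i : σ) (k : ℕ) :
    partialD (K := K) i ^ k = diffOp (X i ^ k) := by
  rw [← diffOpHom_apply, map_pow, diffOpHom_apply, diffOp_X]

theorem partialD_pow_X_pow_mul {σ : Type*} (i : σ) (p k : ℕ) {Q : MvPolynomial σ K}
    (hQ : pderiv i Q = 0) :
    (partialD i ^ p) (X i ^ k * Q) = (k.descFactorial p : K) • (X i ^ (k - p) * Q) := by
  induction p with
  | zero => simp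
  | succ p ih =>
    rw [pow_succ', Module.End.mul_apply, ih, map_smul]
    have h : partialD i (X i ^ (k - p) * Q) = ((k - p : ℕ) : K) • (X i ^ (k - (p + 1)) * Q) := by
      change pderiv i (X i ^ (k - p) * Q) = _
      rw [pderiv_mul, hQ, pderiv_pow, pderiv_X_self, mul_zero, add_zero, mul_one, smul_eq_C_mul,
        map_natCast, mul_assoc, Nat.sub_sub]
    rw [h, smul_smul, Nat.descFactorial_succ, Nat.cast_mul, mul_comm (k.descFactorial p : K)]

variable {n : ℕ}

/-- The substitution `x_{n+1} = y_{n+1} = 0`. -/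
noncomputable def evalLastZero : XYPoly K (n + 1) →ₐ[K] XYPoly K n :=
  aeval (Sum.elim (Fin.snoc (α := fun _ => XYPoly K n) (fun i => X (Sum.inl i)) 0)
    (Fin.snoc (α := fun _ => XYPoly K n) (fun i => X (Sum.inr i)) 0))

theorem evalLastZero_addLastVars (Q : XYPoly K n) : evalLastZero (addLastVars Q) = Q := by
  rw [evalLastZero, addLastVars, aeval_rename]
  conv_rhs => rw [← aeval_X_left_apply Q]
  congr 2
  funext i
  rcases i with i | i <;> simp

theorem evalLastZero_partialD (i : Fin n ⊕ Fin n) (Q : XYPoly K (n + 1)) :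
    evalLastZero (partialD (Sum.map Fin.castSucc Fin.castSucc i) Q) =
      partialD i (evalLastZero Q) := by
  classical
  change evalLastZero (pderiv (Sum.map Fin.castSucc Fin.castSucc i) Q) =
    pderiv i (evalLastZero Q)
  induction Q using MvPolynomial.induction_on with
  | C a => simp [evalLastZero]
  | add P Q hP hQ => simp only [map_add, hP, hQ]
  | mul_X P j hP =>
    rw [pderiv_mul, map_mul evalLastZero P, pderiv_mul, map_add, map_mul, map_mul, hP]
    congr 2
    rcases j with j | j <;> rcases i with i | i <;> refine Fin.lastCases ?_ (fun j => ?_) j <;>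
      simp [evalLastZero, pderiv_X, Pi.single_apply, apply_ite,
        (Fin.castSucc_ne_last _).symm]

theorem evalLastZero_diffOp_addLastVars (P : XYPoly K n) : ∀ Q : XYPoly K (n + 1),
    evalLastZero (diffOp (addLastVars P) Q) = diffOp P (evalLastZero Q) := by
  induction P using MvPolynomial.induction_on with
  | C a =>
    intro Q
    rw [addLastVars, rename_C, diffOp_C, diffOp_C]
    simp
  | add P P' hP hP' =>
    intro Q
    have h : addLastVars (P + P') = addLastVars P + addLastVars P' := map_add _ _ _
    rw [h, diffOp_add, diffOp_add, LinearMap.add_apply, LinearMap.add_apply, map_add, hP, hP']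
  | mul_X P i hP =>
    intro Q
    have h : addLastVars (P * X i) = addLastVars P * X (Sum.map Fin.castSucc Fin.castSucc i) := by
      rw [addLastVars, map_mul, rename_X]; rfl
    rw [h, diffOp_mul, diffOp_mul, diffOp_X, diffOp_X, Module.End.mul_apply, Module.End.mul_apply,
      hP, evalLastZero_partialD]

/-- Up to the factor `p! q!`, the coefficient of `x_{n+1} ^ p y_{n+1} ^ q`. -/
noncomputable def lastCoeff (c : ℕ × ℕ) : XYPoly K (n + 1) →ₗ[K] XYPoly K n :=
  evalLastZero.toLinearMap ∘ₗ
    ((partialD (Sum.inl (Fin.last n)) ^ c.1) * (partialD (Sum.inr (Fin.last n)) ^ c.2))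

/-- Derivatives in the last variables only shift the index of the slice; `b(∂)` commutes with
slicing. -/
theorem lastCoeff_cellDeriv (c p : ℕ × ℕ) (b : XYPoly K n) (Δ : XYPoly K (n + 1)) :
    lastCoeff c (cellDeriv Δ p b) = diffOp b (lastCoeff (c + p) Δ) := by
  simp only [lastCoeff, LinearMap.comp_apply, AlgHom.toLinearMap_apply, cellDeriv,
    ← evalLastZero_diffOp_addLastVars, partialD_pow_eq_diffOp, ← Module.End.mul_apply,
    ← diffOp_mul]
  congr 3
  simp only [Prod.fst_add, Prod.snd_add, pow_add]
  ring

theorem pderiv_addLastVars {i : Fin (n + 1) ⊕ Fin (n + 1)}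
    (hi : i ∉ Set.range (Sum.map (Fin.castSucc (n := n)) (Fin.castSucc (n := n))))
    (Q : XYPoly K n) : pderiv i (addLastVars Q) = 0 := by
  classical
  refine pderiv_eq_zero_of_notMem_vars fun h => hi ?_
  obtain ⟨j, -, hj⟩ := Finset.mem_image.1 (vars_rename _ _ h)
  exact ⟨j, hj⟩

theorem lastCoeff_monomial_mul (c d : ℕ × ℕ) (Q : XYPoly K n) :
    lastCoeff c (X (Sum.inl (Fin.last n)) ^ d.1 * X (Sum.inr (Fin.last n)) ^ d.2 * addLastVars Q) =
      if d = c then ((c.1 ! * c.2 ! : ℕ) : K) • Q else 0 := by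
  have hx : pderiv (Sum.inl (Fin.last n)) (addLastVars Q) = 0 :=
    pderiv_addLastVars (by rintro ⟨j | j, hj⟩ <;> simp [Fin.castSucc_ne_last] at hj) Q
  have hy : pderiv (Sum.inr (Fin.last n)) (addLastVars Q) = 0 :=
    pderiv_addLastVars (by rintro ⟨j | j, hj⟩ <;> simp [Fin.castSucc_ne_last] at hj) Q
  have hxy : pderiv (Sum.inl (Fin.last n))
      (X (Sum.inr (Fin.last n)) ^ (d.2 - c.2) * addLastVars Q) = 0 := by
    rw [pderiv_mul, hx, pderiv_pow, pderiv_X_of_ne (by simp)]; simp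
  have hyx : pderiv (Sum.inr (Fin.last n))
      (X (Sum.inl (Fin.last n)) ^ d.1 * addLastVars Q) = 0 := by
    rw [pderiv_mul, hy, pderiv_pow, pderiv_X_of_ne (by simp)]; simp
  rw [mul_assoc, mul_left_comm, lastCoeff, LinearMap.comp_apply, Module.End.mul_apply,
    partialD_pow_X_pow_mul _ _ _ hyx, map_smul, mul_left_comm, partialD_pow_X_pow_mul _ _ _ hxy,
    map_smul, map_smul, AlgHom.toLinearMap_apply, map_mul, map_mul, map_pow, map_pow,
    evalLastZero_addLastVars]
  have h0 : evalLastZero (K := K) (X (Sum.inl (Fin.last n))) = 0 := by simp [evalLastZero]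
  have h0' : evalLastZero (K := K) (X (Sum.inr (Fin.last n))) = 0 := by simp [evalLastZero]
  rw [h0, h0']
  split_ifs with h
  · subst h
    simp [Nat.descFactorial_self, smul_smul, mul_comm]
  · have h' : d.1 < c.1 ∨ c.1 < d.1 ∨ d.2 < c.2 ∨ c.2 < d.2 := by
      by_contra! hc
      exact h (Prod.ext (by omega) (by omega))
    rcases h' with h | h | h | h
    · simp [Nat.descFactorial_of_lt h]
    · simp [zero_pow (Nat.sub_ne_zero_of_lt h)]
    · simp [Nat.descFactorial_of_lt h]
    · simp [zero_pow (Nat.sub_ne_zero_of_lt h)]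

/-- Laplace expansion along the last row, the only one that contains the last variables. -/
theorem lastCoeff_latticeDet (e : Fin (n + 1) → ℕ × ℕ) (c : ℕ × ℕ) :
    lastCoeff c (latticeDet K e) = ∑ j : Fin (n + 1), ((-1 : K) ^ (n + (j : ℕ))) •
      if e j = c then ((c.1 ! * c.2 ! : ℕ) : K) • latticeDet K (e ∘ j.succAbove) else 0 := by
  rw [latticeDet, Matrix.det_succ_row _ (Fin.last n), map_sum]
  refine Finset.sum_congr rfl fun j _ => ?_
  rw [← lastCoeff_monomial_mul, ← map_smul]
  congr 1
  have hminor : (Matrix.of fun i j : Fin (n + 1) =>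
      (X (Sum.inl i) ^ (e j).1 * X (Sum.inr i) ^ (e j).2 : XYPoly K (n + 1))).submatrix
        (Fin.last n).succAbove j.succAbove =
      (rename (Sum.map Fin.castSucc Fin.castSucc)).mapMatrix (Matrix.of fun i j' : Fin n =>
        (X (Sum.inl i) ^ (e (j.succAbove j')).1 * X (Sum.inr i) ^ (e (j.succAbove j')).2 :
          XYPoly K n)) := by
    ext1 i j'
    simp
  rw [hminor, ← AlgHom.map_det, Matrix.of_apply, addLastVars, latticeDet, smul_eq_C_mul,
    Fin.val_last, map_pow, map_neg, map_one, mul_assoc]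
  rfl

theorem lastCoeff_latticeDet_of_notMem {e : Fin (n + 1) → ℕ × ℕ} {c : ℕ × ℕ} (h : ∀ j, e j ≠ c) :
    lastCoeff c (latticeDet K e) = 0 := by
  rw [lastCoeff_latticeDet]
  exact Finset.sum_eq_zero fun j _ => by rw [if_neg (h j), smul_zero]

theorem lastCoeff_deltaPoly_of_notMem (μ : YoungDiagram) (h : μ.card = n + 1) {c : ℕ × ℕ}
    (hc : c ∉ μ.cells) : lastCoeff c (deltaPoly K μ h) = 0 :=
  lastCoeff_latticeDet_of_notMem fun j hj => hc (hj ▸ biexponent_mem μ h j)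

/-- Deleting one cell preserves the lexicographic order of the others, so the minor is the
determinant of the smaller diagram with no extra sign. -/
theorem biexponent_comp_succAbove {μ α : YoungDiagram} (h : μ.card = n + 1) (hα : α.card = n)
    (j : Fin (n + 1)) (hcells : α.cells = μ.cells.erase (biexponent μ h j)) :
    biexponent μ h ∘ j.succAbove = biexponent α hα := by
  have h1 : (fun i => toLex (biexponent μ h (j.succAbove i))) =
      (α.cells.map toLex.toEmbedding).orderEmbOfFin ((Finset.card_map _).trans hα) := by
    refine Finset.orderEmbOfFin_unique _ (fun i => ?_) ?_
    · have h2 : biexponent μ h (j.succAbove i) ∈ α.cells := by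
        rw [hcells]
        refine Finset.mem_erase.2 ⟨fun hij => ?_, biexponent_mem μ h _⟩
        exact Fin.succAbove_ne j i ((strictMono_biexponent μ h).injective (congrArg toLex hij))
      simpa using h2
    · exact (strictMono_biexponent μ h).comp (Fin.strictMono_succAbove j)
  funext i
  exact toLex.injective (congrFun h1 i)

theorem exists_lastCoeff_deltaPoly [CharZero K] {μ α : YoungDiagram} (h : μ.card = n + 1)
    (hα : α.card = n) {c : ℕ × ℕ} (hc : c ∈ μ.cells) (hcells : α.cells = μ.cells.erase c) :
    ∃ u : K, u ≠ 0 ∧ lastCoeff c (deltaPoly K μ h) = u • deltaPoly K α hα := by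
  obtain ⟨j, rfl⟩ := exists_biexponent_eq μ h hc
  have hinj : Function.Injective (biexponent μ h) := fun i j hij =>
    (strictMono_biexponent μ h).injective (congrArg toLex hij)
  refine ⟨(-1 : K) ^ (n + (j : ℕ)) * ((biexponent μ h j).1 ! * (biexponent μ h j).2 ! : ℕ), ?_, ?_⟩
  · refine mul_ne_zero (pow_ne_zero _ (by simp)) (Nat.cast_ne_zero.2 ?_)
    exact mul_ne_zero (Nat.factorial_ne_zero _) (Nat.factorial_ne_zero _)
  · rw [deltaPoly_eq_latticeDet, lastCoeff_latticeDet, Finset.sum_eq_single j, if_pos rfl,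
      biexponent_comp_succAbove h hα j hcells, smul_smul, deltaPoly_eq_latticeDet]
    · intro i _ hij
      rw [if_neg fun hh => hij (hinj hh), smul_zero]
    · simp

end Slices

/-! ### Triangularity over the cells -/

section Independence

variable {K : Type*} [Field K] [LinearOrder K] [IsStrictOrderedRing K]
  {σ : Type*} [Fintype σ]

/-- The triangularity argument: in a relation between the derivatives attached to the cells of a
two-corner diagram, the operators `f p` vanish one after the other. -/
theorem forall_eq_zero_of_cell_relations {la lb a c : ℕ} (hla : 0 < la) (hlb : 0 < lb) (ha : 0 < a)
    (hc : 0 < c) {cells : Finset (ℕ × ℕ)}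
    (hcells : ∀ r s, (r, s) ∈ cells ↔ (r < lb ∧ s < a + c) ∨ (r < lb + la ∧ s < a))
    {D : ℕ × ℕ → MvPolynomial σ K} (hD : ∀ p, p ∉ cells → D p = 0)
    {ΔA ΔB : MvPolynomial σ K} {u v : K} (hu : u ≠ 0) (hv : v ≠ 0)
    (hDA : D (lb + la - 1, a - 1) = u • ΔA) (hDB : D (lb - 1, a + c - 1) = v • ΔB)
    {f : ℕ × ℕ → MvPolynomial σ K}
    (hf : ∀ d : ℕ × ℕ, ∑ p ∈ cells, diffOp (f p) (D (d + p)) = 0)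
    (hUPR : ∀ r s, lb ≤ r → r < lb + la → s < a → f (r, s) ∈ LinearMap.range (flipLin ΔA))
    (hINS : ∀ r s, r < lb → s < a → s < c →
      f (r, s) ∈ LinearMap.range (flipLin ΔA) ⊔ LinearMap.range (flipLin ΔB))
    (hMIDA : ∀ r s, r < lb → c ≤ s → s < a → f (r, s) ∈ LinearMap.range (flipLin ΔA))
    (hMIDB : ∀ r s, r < lb → a ≤ s → s < c → f (r, s) ∈ LinearMap.range (flipLin ΔB))
    (hOUT : ∀ r s, r < lb → a ≤ s → c ≤ s → s < a + c →
      diffOp (f (r, s)) ΔB ∈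
        orthCompl (LinearMap.range (flipLin ΔA) ⊓ LinearMap.range (flipLin ΔB)) ∧
      (diffOp (f (r, s)) ΔB = 0 → f (r, s) = 0)) :
    ∀ p ∈ cells, f p = 0 := by
  have hcorner : ∀ {P Δ : MvPolynomial σ K} {w : K}, w ≠ 0 → diffOp P (w • Δ) = 0 →
      diffOp P Δ = 0 := by
    intro P Δ w hw h
    rw [map_smul] at h
    exact (smul_eq_zero.1 h).resolve_left hw
  have hzero : ∀ {P Δ : MvPolynomial σ K}, diffOp P Δ = 0 → P ∈ LinearMap.range (flipLin Δ) →
      P = 0 := fun h h' => eq_zero_of_flip_eq_zero h h (by rwa [sup_idem])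
  -- Lexicographic induction on $(R,S)$. An OUT cell $(r,s)$ is treated not at its own turn but at
  -- $(r+l_a,\,s-c)$: the translation taking that cell to the corner of $\alpha$ takes $(r,s)$ to
  -- the corner of $\beta$.
  have main : ∀ R S : ℕ, ((R, S) ∈ cells → ¬ (R < lb ∧ a ≤ S ∧ c ≤ S) → f (R, S) = 0) ∧
      (∀ r, r < lb → a ≤ S + c → S < a → r + la = R → f (r, S + c) = 0) := by
    intro R
    induction R using Nat.strong_induction_on with
    | _ R ihR =>
    intro S
    induction S using Nat.strong_induction_on with
    | _ S ihS =>
    have early : ∀ r s, (r, s) ∈ cells → ¬ (r < lb ∧ a ≤ s ∧ c ≤ s) →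
        (r < R ∨ r = R ∧ s < S) → f (r, s) = 0 := by
      rintro r s hrs hn (h | ⟨rfl, h⟩)
      · exact (ihR r h s).1 hrs hn
      · exact (ihS s h).1 hrs hn
    have earlyOut : ∀ r s, r < lb → a ≤ s → c ≤ s → s < a + c →
        (r + la < R ∨ r + la = R ∧ s < S + c) → f (r, s) = 0 := by
      intro r s h1 h2 h3 h4 h
      obtain ⟨s, rfl⟩ := Nat.exists_eq_add_of_le' h3
      rcases h with h | ⟨h, h'⟩
      · exact (ihR _ h s).2 r h1 h2 (by omega) rfl
      · exact (ihS s (by omega)).2 r h1 h2 (by omega) h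
    have killA : R < lb + la → S < a → diffOp (f (R, S)) ΔA = 0 ∧
        (∀ r, r < lb → a ≤ S + c → r + la = R → f (r, S + c) = 0) := by
      intro hR hS
      -- This shift moves $(R,S)$ onto the corner of $\alpha$. The cells remaining in the diagram
      -- satisfy $r\le R,\ s\le S$ or $r+l_a\le R,\ s\le S+c$.
      have hrel := hf (lb + la - 1 - R, a - 1 - S)
      have hRS : (R, S) ∈ cells := (hcells R S).2 (Or.inr ⟨hR, hS⟩)
      have hDRS : D ((lb + la - 1 - R, a - 1 - S) + (R, S)) = u • ΔA := by
        rw [← hDA, Prod.mk_add_mk]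
        congr 2 <;> omega
      have hrest : ∀ r s, (r, s) ∈ cells → (r, s) ≠ (R, S) →
          ¬ (r + la = R ∧ r < lb ∧ a ≤ s ∧ s = S + c) →
          diffOp (f (r, s)) (D ((lb + la - 1 - R, a - 1 - S) + (r, s))) = 0 := by
        intro r s hrs hne hnp
        rw [ne_eq, Prod.mk.injEq] at hne
        by_cases ht : (lb + la - 1 - R, a - 1 - S) + (r, s) ∈ cells
        · rw [Prod.mk_add_mk, hcells] at ht
          have hrs' := (hcells r s).1 hrs
          have : f (r, s) = 0 := by
            by_cases hout : r < lb ∧ a ≤ s ∧ c ≤ s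
            · exact earlyOut r s hout.1 hout.2.1 hout.2.2 (by omega) (by omega)
            · exact early r s hrs hout (by omega)
          rw [this, ← diffOpHom_apply, map_zero, LinearMap.zero_apply]
        · rw [hD _ ht, map_zero]
      -- If $S+c<a$, the cell $(R-l_a,S+c)$ is not in OUT and lies in an earlier row, so its
      -- operator is already zero and a single term survives.
      by_cases hp : ∃ r, r + la = R ∧ r < lb ∧ a ≤ S + c
      · obtain ⟨r, hr, hrlb, haS⟩ := hp
        have hne : (R, S) ≠ (r, S + c) := by
          rw [ne_eq, Prod.mk.injEq]; omega
        have hmem : (r, S + c) ∈ cells := (hcells _ _).2 (Or.inl ⟨hrlb, by omega⟩)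
        have hDr : D ((lb + la - 1 - R, a - 1 - S) + (r, S + c)) = v • ΔB := by
          rw [← hDB, Prod.mk_add_mk]
          congr 2 <;> omega
        have hsub : ({(R, S), (r, S + c)} : Finset (ℕ × ℕ)) ⊆ cells := by
          intro p hp
          rw [Finset.mem_insert, Finset.mem_singleton] at hp
          rcases hp with rfl | rfl <;> assumption
        rw [← Finset.sum_subset hsub, Finset.sum_pair hne, hDRS, hDr] at hrel
        · obtain ⟨horth, hinj⟩ := hOUT r (S + c) hrlb haS (by omega) (by omega)
          have hAB : v • diffOp (f (r, S + c)) ΔB = -(u • diffOp (f (R, S)) ΔA) := by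
            rw [← map_smul, ← map_smul]
            exact eq_neg_of_add_eq_zero_right hrel
          -- The relation puts this flip in $\mathbf M_\alpha\cap\mathbf M_\beta$, to which it is
          -- also orthogonal.
          have hB0 : diffOp (f (r, S + c)) ΔB = 0 := by
            refine eq_zero_of_mem_orthCompl horth ⟨?_, ⟨_, flipLin_apply _ _⟩⟩
            have : diffOp (f (r, S + c)) ΔB = v⁻¹ • -(u • diffOp (f (R, S)) ΔA) := by
              rw [← hAB, smul_smul, inv_mul_cancel₀ hv, one_smul]
            rw [this]
            exact Submodule.smul_mem _ _ (Submodule.neg_mem _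
              (Submodule.smul_mem _ _ ⟨_, flipLin_apply _ _⟩))
          refine ⟨?_, fun r' _ _ hr' => ?_⟩
          · rw [hB0, smul_zero, zero_eq_neg] at hAB
            exact (smul_eq_zero.1 hAB).resolve_left hu
          · rw [show r' = r by omega]
            exact hinj hB0
        · rintro ⟨r', s'⟩ hrs hn
          rw [Finset.mem_insert, Finset.mem_singleton, not_or] at hn
          refine hrest r' s' hrs hn.1 fun h => hn.2 ?_
          rw [Prod.mk.injEq]; omega
      · refine ⟨?_, fun r h1 h2 h3 => absurd ⟨r, h3, h1, h2⟩ hp⟩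
        rw [Finset.sum_eq_single_of_mem _ hRS, hDRS] at hrel
        · exact hcorner hu hrel
        · rintro ⟨r, s⟩ hrs hne
          exact hrest r s hrs hne fun h => hp ⟨r, h.1, h.2.1, by omega⟩
    have killB : R < lb → S < c → diffOp (f (R, S)) ΔB = 0 := by
      intro hR hS
      -- This shift moves $(R,S)$ onto the corner of $\beta$. Since $S<c$, no cell moves into the
      -- rows of length $a$, so every other surviving cell is earlier and outside OUT.
      have hrel := hf (lb - 1 - R, a + c - 1 - S)
      have hRS : (R, S) ∈ cells := (hcells R S).2 (Or.inl ⟨hR, by omega⟩)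
      have hDRS : D ((lb - 1 - R, a + c - 1 - S) + (R, S)) = v • ΔB := by
        rw [← hDB, Prod.mk_add_mk]
        congr 2 <;> omega
      rw [Finset.sum_eq_single_of_mem _ hRS, hDRS] at hrel
      · exact hcorner hv hrel
      · rintro ⟨r, s⟩ hrs hne
        rw [ne_eq, Prod.mk.injEq] at hne
        by_cases ht : (lb - 1 - R, a + c - 1 - S) + (r, s) ∈ cells
        · rw [Prod.mk_add_mk, hcells] at ht
          rw [early r s hrs (by omega) (by omega), ← diffOpHom_apply, map_zero,
            LinearMap.zero_apply]
        · rw [hD _ ht, map_zero]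
    refine ⟨fun hRS hn => ?_, fun r h1 h2 h3 h4 => (killA (by omega) h3).2 r h1 h2 h4⟩
    rw [hcells] at hRS
    by_cases hR : R < lb
    · by_cases hS : S < a
      · by_cases hSc : S < c
        · exact eq_zero_of_flip_eq_zero (killA (by omega) hS).1 (killB hR hSc) (hINS R S hR hS hSc)
        · exact hzero (killA (by omega) hS).1 (hMIDA R S hR (by omega) hS)
      · have hSc : S < c := by omega
        exact hzero (killB hR hSc) (hMIDB R S hR (by omega) hSc)
    · exact hzero (killA (by omega) (by omega)).1 (hUPR R S (by omega) (by omega) (by omega))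
  rintro ⟨r, s⟩ hrs
  by_cases hout : r < lb ∧ a ≤ s ∧ c ≤ s
  · rw [hcells] at hrs
    obtain ⟨s, rfl⟩ := Nat.exists_eq_add_of_le' hout.2.2
    exact (main (r + la) s).2 r hout.1 hout.2.1 (by omega) rfl
  · exact (main r s).1 hrs hout

end Independence

/-! ### Counting the family -/

section Counting

theorem mem_cells_of_rowLens_two_corners {μ : YoungDiagram} {la lb a c : ℕ}
    (hμ : μ.rowLens = List.replicate lb (a + c) ++ List.replicate la a) (r s : ℕ) :
    (r, s) ∈ μ.cells ↔ (r < lb ∧ s < a + c) ∨ (r < lb + la ∧ s < a) := by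
  have hlen : μ.colLen 0 = lb + la := by
    rw [← YoungDiagram.length_rowLens, hμ]; simp
  rw [YoungDiagram.mem_cells]
  by_cases hr : r < lb + la
  · have h1 : μ.rowLens[r]? = some (μ.rowLen r) := by
      simp [YoungDiagram.rowLens, hlen, hr]
    rw [hμ] at h1
    rw [YoungDiagram.mem_iff_lt_rowLen]
    by_cases hrb : r < lb
    · rw [List.getElem?_append_left (by simpa using hrb), List.getElem?_replicate, if_pos hrb,
        Option.some_inj] at h1
      omega
    · rw [List.getElem?_append_right (by simpa using hrb), List.getElem?_replicate, if_pos
        (by simp; omega), Option.some_inj] at h1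
      omega
  · have : (r, s) ∉ μ := fun h => by
      have h2 := YoungDiagram.mem_iff_lt_colLen.1 (μ.up_left_mem le_rfl (Nat.zero_le s) h)
      omega
    simp only [this, false_iff]
    omega

/-- The weight $1+[s<a]+[s<c]$ covers INS, MID and OUT whether or not $a<c$. Over a row of length
$a+c$ it sums to $(a+c)+a+c$, an average of $2$. -/
theorem sum_cellWeight {la lb a c : ℕ} {cells : Finset (ℕ × ℕ)}
    (hcells : ∀ r s, (r, s) ∈ cells ↔ (r < lb ∧ s < a + c) ∨ (r < lb + la ∧ s < a)) (k : ℕ) :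
    ∑ p ∈ cells, k * (if p.1 < lb then
      1 + (if p.2 < a then 1 else 0) + (if p.2 < c then 1 else 0) else 2) = cells.card * (2 * k) := by
  have hdec : cells = (Finset.range lb ×ˢ Finset.range (a + c)) ∪
      (Finset.Ico lb (lb + la) ×ˢ Finset.range a) := by
    ext ⟨r, s⟩
    rw [hcells]
    simp only [Finset.mem_union, Finset.mem_product, Finset.mem_range, Finset.mem_Ico]
    omega
  have hdisj : Disjoint (Finset.range lb ×ˢ Finset.range (a + c))
      (Finset.Ico lb (lb + la) ×ˢ Finset.range a) := by
    rw [Finset.disjoint_left]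
    rintro ⟨r, s⟩ h1 h2
    simp only [Finset.mem_product, Finset.mem_range, Finset.mem_Ico] at h1 h2
    omega
  have hind : ∀ x y, ∑ s ∈ Finset.range (x + y), (if s < x then 1 else 0) = x := by
    intro x y
    rw [Finset.sum_boole]
    have : (Finset.range (x + y)).filter (fun s => s < x) = Finset.range x := by
      ext s; simp only [Finset.mem_filter, Finset.mem_range]; omega
    simp [this]
  have hrow : ∑ s ∈ Finset.range (a + c),
      (1 + (if s < a then 1 else 0) + (if s < c then 1 else 0)) = 2 * (a + c) := by
    rw [Finset.sum_add_distrib, Finset.sum_add_distrib, hind a c]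
    conv_lhs => arg 2; rw [add_comm a c]
    rw [hind c a]
    simp
    ring
  have h1 : ∀ r ∈ Finset.range lb, ∑ s ∈ Finset.range (a + c), k * (if r < lb then
      1 + (if s < a then 1 else 0) + (if s < c then 1 else 0) else 2) = k * (2 * (a + c)) := by
    intro r hr
    rw [← hrow, Finset.mul_sum]
    exact Finset.sum_congr rfl fun s _ => by rw [if_pos (Finset.mem_range.1 hr)]
  have h2 : ∀ r ∈ Finset.Ico lb (lb + la), ∑ s ∈ Finset.range a, k * (if r < lb then
      1 + (if s < a then 1 else 0) + (if s < c then 1 else 0) else 2) = a * (k * 2) := by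
    intro r hr
    rw [← smul_eq_mul a, ← Finset.card_range a, ← Finset.sum_const, Finset.card_range]
    exact Finset.sum_congr rfl fun s _ => by rw [if_neg (not_lt.2 (Finset.mem_Ico.1 hr).1)]
  rw [hdec, Finset.sum_union hdisj, Finset.card_union_of_disjoint hdisj, Finset.sum_product,
    Finset.sum_product, Finset.sum_congr rfl h1, Finset.sum_congr rfl h2]
  simp only [Finset.sum_const, Finset.card_product, Finset.card_range, Nat.card_Ico, smul_eq_mul,
    Nat.add_sub_cancel_left]
  ring

end Counting

/-! ### Bases and orthogonal complements -/

section Bases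

variable {K : Type*} [Field K]

/-- Rank–nullity for the pairing map from `V` to the dual of `W`, whose kernel is the part of `V`
orthogonal to `W`. Only this inequality is needed, to bound the size of $\mathcal B^*$ from below.
-/
theorem finrank_le_finrank_orthCompl_inf {σ : Type*} {V W : Submodule K (MvPolynomial σ K)}
    [Module.Finite K V] [Module.Finite K W] :
    Module.finrank K V ≤ Module.finrank K W + Module.finrank K ↥(orthCompl W ⊓ V) := by
  let F : V →ₗ[K] Module.Dual K W := LinearMap.mk₂ K
    (fun P Q => scalarProd (Q : MvPolynomial σ K) (P : MvPolynomial σ K))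
    (fun P P' Q => by simp [scalarProd]) (fun t P Q => by simp [scalarProd])
    (fun P Q Q' => by simp [scalarProd, diffOp_add])
    (fun t P Q => by simp [scalarProd, ← diffOpHom_apply])
  have h1 := LinearMap.finrank_range_add_finrank_ker F
  have h2 : Module.finrank K (LinearMap.range F) ≤ Module.finrank K W := by
    rw [← Subspace.dual_finrank_eq (K := K) (V := W)]
    exact Submodule.finrank_le _
  have h3 : (LinearMap.ker F).map V.subtype ≤ orthCompl W ⊓ V := by
    rintro _ ⟨P, hP, rfl⟩
    refine ⟨fun Q hQ => ?_, P.2⟩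
    exact LinearMap.congr_fun (LinearMap.mem_ker.1 hP) ⟨Q, hQ⟩
  have h4 : Module.finrank K (LinearMap.ker F) ≤ Module.finrank K ↥(orthCompl W ⊓ V) := by
    rw [(Submodule.equivMapOfInjective V.subtype V.injective_subtype _).finrank_eq]
    have : Module.Finite K ↥(orthCompl W ⊓ V) := Submodule.finiteDimensional_inf_right _ _
    exact Submodule.finrank_mono h3
  omega

theorem exists_isBasisOf {V : Type*} [AddCommGroup V] [Module K V] (W : Submodule K V) :
    ∃ S : Set V, IsBasisOf (fun P : S => (P : V)) W := by
  obtain ⟨S, -, hspan, hind⟩ := exists_linearIndependent K (W : Set V)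
  exact ⟨S, hind, by rw [Subtype.range_coe, hspan, Submodule.span_eq]⟩

theorem exists_isBasisOf_comp {V V' : Type*} [AddCommGroup V] [Module K V] [AddCommGroup V']
    [Module K V'] (F : V' → V) (W : Submodule K V) (hW : ∀ x ∈ W, ∃ y, F y = x) :
    ∃ S : Set V', IsBasisOf (fun P : S => F P) W := by
  obtain ⟨S, hind, hspan⟩ := exists_isBasisOf W
  have hS : ∀ x : S, ∃ y, F y = x := fun x =>
    hW x (hspan ▸ Submodule.subset_span ⟨x, rfl⟩)
  choose g hg using hS
  have hinj : Function.Injective g := fun x y h => Subtype.ext (by rw [← hg, h, hg])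
  refine ⟨Set.range g, ?_, ?_⟩
  · rw [← linearIndependent_equiv (Equiv.ofInjective g hinj)]
    convert hind using 2 with x
    exact hg x
  · rw [← hspan]
    congr 1
    ext x
    constructor
    · rintro ⟨⟨_, y, rfl⟩, rfl⟩
      exact ⟨y, (hg y).symm⟩
    · rintro ⟨y, rfl⟩
      exact ⟨⟨g y, y, rfl⟩, hg y⟩

theorem IsBasisOf.finite {V ι : Type*} [AddCommGroup V] [Module K V] {v : ι → V}
    {W : Submodule K V} (h : IsBasisOf v W) [Module.Finite K W] : Finite ι := by
  obtain ⟨h1, rfl⟩ := h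
  exact (linearIndependent_span h1).finite

theorem IsBasisOf.card_eq {V ι : Type*} [AddCommGroup V] [Module K V] {v : ι → V}
    {W : Submodule K V} (h : IsBasisOf v W) [Fintype ι] : Fintype.card ι = Module.finrank K W := by
  obtain ⟨h1, rfl⟩ := h
  exact (finrank_span_eq_card h1).symm

theorem IsBasisOf.sum_mem {V ι : Type*} [AddCommGroup V] [Module K V] {v : ι → V}
    {W : Submodule K V} (h : IsBasisOf v W) [Fintype ι] (g : ι → K) : ∑ i, g i • v i ∈ W := by
  obtain ⟨-, rfl⟩ := h
  exact Submodule.sum_mem _ fun i _ => Submodule.smul_mem _ _ (Submodule.subset_span ⟨i, rfl⟩)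

theorem IsBasisOf.of_linearIndependent {V ι : Type*} [AddCommGroup V] [Module K V] {v : ι → V}
    {W : Submodule K V} [Module.Finite K W] [Fintype ι] (hv : LinearIndependent K v)
    (hmem : ∀ i, v i ∈ W) (hcard : Module.finrank K W ≤ Fintype.card ι) : IsBasisOf v W := by
  refine ⟨hv, Submodule.eq_of_le_of_finrank_le ?_ ?_⟩
  · rw [Submodule.span_le]
    rintro _ ⟨i, rfl⟩
    exact hmem i
  · rwa [finrank_span_eq_card hv]

theorem cellDeriv_mem_derivSpan {n : ℕ} (μ : YoungDiagram) (h : μ.card = n + 1) (p : ℕ × ℕ)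
    (b : XYPoly K n) : cellDeriv (deltaPoly K μ h) p b ∈ derivSpan K μ h := by
  rw [derivSpan_eq_range]
  refine ⟨addLastVars b * (X (Sum.inl (Fin.last n)) ^ p.1 * X (Sum.inr (Fin.last n)) ^ p.2), ?_⟩
  rw [flipLin_apply, diffOp_mul, diffOp_mul, cellDeriv, partialD_pow_eq_diffOp,
    partialD_pow_eq_diffOp]
  rfl

end Bases

/-! ### The basis of $\mathbf M_\mu$ -/

section TwoCorners

variable {K : Type*} [Field K] [LinearOrder K] [IsStrictOrderedRing K]

/-- The regions are given by inequalities that treat $a<c$ and $c\le a$ alike, and the basis may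
vary from cell to cell within a region. -/
theorem isBasisOf_cellDeriv_of_two_corners
    {n la lb a c : ℕ} (hla : 0 < la) (hlb : 0 < lb) (ha : 0 < a) (hc : 0 < c)
    {μ α β : YoungDiagram} (hμ : μ.card = n + 1) (hα : α.card = n) (hβ : β.card = n)
    (hcells : ∀ r s, (r, s) ∈ μ.cells ↔ (r < lb ∧ s < a + c) ∨ (r < lb + la ∧ s < a))
    (hαμ : α.cells = μ.cells.erase (lb + la - 1, a - 1))
    (hβμ : β.cells = μ.cells.erase (lb - 1, a + c - 1))
    (hdimα : Module.finrank K (derivSpan K α hα) = n !)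
    (hdimβ : Module.finrank K (derivSpan K β hβ) = n !)
    (hdimαβ : 2 * Module.finrank K ↥(derivSpan K α hα ⊓ derivSpan K β hβ) = n !)
    {B : ℕ × ℕ → Set (XYPoly K n)}
    (hUPR : ∀ r s, lb ≤ r → r < lb + la → s < a →
      IsBasisOf (fun P : B (r, s) => (P : XYPoly K n)) (derivSpan K α hα))
    (hINS : ∀ r s, r < lb → s < a → s < c →
      IsBasisOf (fun P : B (r, s) => (P : XYPoly K n)) (derivSpan K α hα ⊔ derivSpan K β hβ))
    (hMIDA : ∀ r s, r < lb → c ≤ s → s < a →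
      IsBasisOf (fun P : B (r, s) => (P : XYPoly K n)) (derivSpan K α hα))
    (hMIDB : ∀ r s, r < lb → a ≤ s → s < c →
      IsBasisOf (fun P : B (r, s) => (P : XYPoly K n)) (derivSpan K β hβ))
    (hOUT : ∀ r s, r < lb → a ≤ s → c ≤ s → s < a + c →
      IsBasisOf (fun P : B (r, s) => flipBy (deltaPoly K β hβ) (P : XYPoly K n))
        (orthCompl (derivSpan K α hα ⊓ derivSpan K β hβ) ⊓ derivSpan K β hβ)) :
    Module.finrank K (derivSpan K μ hμ) = (n + 1)! ∧
    IsBasisOf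
      (fun i : (p : {p : ℕ × ℕ // p ∈ μ.cells}) × B p.1 =>
        cellDeriv (deltaPoly K μ hμ) i.1.1 (i.2 : XYPoly K n))
      (derivSpan K μ hμ) := by
  classical
  set MA := derivSpan K α hα with hMA
  set MB := derivSpan K β hβ with hMB
  have : Module.Finite K MA := (finite_and_finrank_derivSpan_le α hα).1
  have : Module.Finite K MB := (finite_and_finrank_derivSpan_le β hβ).1
  have : Module.Finite K ↥(MA ⊓ MB) := Submodule.finiteDimensional_inf_right _ _
  have : Module.Finite K ↥(MA ⊔ MB) := Submodule.finite_sup _ _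
  have : Module.Finite K ↥(orthCompl (MA ⊓ MB) ⊓ MB) := Submodule.finiteDimensional_inf_right _ _
  obtain ⟨hfinμ, hleμ⟩ := finite_and_finrank_derivSpan_le (K := K) μ hμ
  have hflip : ∀ P : XYPoly K n,
      flipBy (deltaPoly K β hβ) P = flipLin (deltaPoly K β hβ) P := fun P =>
    (flipLin_apply _ _).symm
  have hregion : ∀ r s, (r, s) ∈ μ.cells →
      (lb ≤ r ∧ r < lb + la ∧ s < a) ∨ (r < lb ∧ s < a ∧ s < c) ∨ (r < lb ∧ c ≤ s ∧ s < a) ∨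
        (r < lb ∧ a ≤ s ∧ s < c) ∨ (r < lb ∧ a ≤ s ∧ c ≤ s ∧ s < a + c) := by
    intro r s h
    rw [hcells] at h
    omega
  have hfin : ∀ p : {p : ℕ × ℕ // p ∈ μ.cells}, Finite (B p.1) := by
    rintro ⟨⟨r, s⟩, hp⟩
    rcases hregion r s hp with h | h | h | h | h
    · exact (hUPR r s h.1 h.2.1 h.2.2).finite
    · exact (hINS r s h.1 h.2.1 h.2.2).finite
    · exact (hMIDA r s h.1 h.2.1 h.2.2).finite
    · exact (hMIDB r s h.1 h.2.1 h.2.2).finite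
    · exact (hOUT r s h.1 h.2.1 h.2.2.1 h.2.2.2).finite
  have hind : ∀ p : {p : ℕ × ℕ // p ∈ μ.cells},
      LinearIndependent K fun P : B p.1 => (P : XYPoly K n) := by
    rintro ⟨⟨r, s⟩, hp⟩
    rcases hregion r s hp with h | h | h | h | h
    · exact (hUPR r s h.1 h.2.1 h.2.2).1
    · exact (hINS r s h.1 h.2.1 h.2.2).1
    · exact (hMIDA r s h.1 h.2.1 h.2.2).1
    · exact (hMIDB r s h.1 h.2.1 h.2.2).1
    · have := (hOUT r s h.1 h.2.1 h.2.2.1 h.2.2.2).1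
      simp only [hflip] at this
      exact LinearIndependent.of_comp (flipLin (deltaPoly K β hβ)) this
  let hft : ∀ p : {p : ℕ × ℕ // p ∈ μ.cells}, Fintype (B p.1) := fun p => Fintype.ofFinite _
  have hcard : (n + 1)! ≤ Fintype.card ((p : {p : ℕ × ℕ // p ∈ μ.cells}) × B p.1) := by
    set k := Module.finrank K ↥(MA ⊓ MB) with hk
    have hsup := Submodule.finrank_sup_add_finrank_inf_eq MA MB
    have horth : Module.finrank K MB ≤ k + Module.finrank K ↥(orthCompl (MA ⊓ MB) ⊓ MB) :=
      finrank_le_finrank_orthCompl_inf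
    rw [Fintype.card_sigma, Nat.factorial_succ, ← hμ, YoungDiagram.card, ← hdimαβ,
      ← sum_cellWeight hcells k, ← Finset.sum_coe_sort μ.cells]
    refine Finset.sum_le_sum ?_
    rintro ⟨⟨r, s⟩, hp⟩ -
    let _ : Fintype (B (r, s)) := hft ⟨(r, s), hp⟩
    rcases hregion r s hp with h | h | h | h | h
    · rw [(hUPR r s h.1 h.2.1 h.2.2).card_eq, if_neg (not_lt.2 h.1)]
      omega
    · rw [(hINS r s h.1 h.2.1 h.2.2).card_eq, if_pos h.1, if_pos h.2.1, if_pos h.2.2]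
      omega
    · rw [(hMIDA r s h.1 h.2.1 h.2.2).card_eq, if_pos h.1, if_pos h.2.2, if_neg (not_lt.2 h.2.1)]
      omega
    · rw [(hMIDB r s h.1 h.2.1 h.2.2).card_eq, if_pos h.1, if_neg (not_lt.2 h.2.1), if_pos h.2.2]
      omega
    · rw [(hOUT r s h.1 h.2.1 h.2.2.1 h.2.2.2).card_eq, if_pos h.1, if_neg (not_lt.2 h.2.1),
        if_neg (not_lt.2 h.2.2.1)]
      omega
  have hlin : LinearIndependent K fun i : (p : {p : ℕ × ℕ // p ∈ μ.cells}) × B p.1 =>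
      cellDeriv (deltaPoly K μ hμ) i.1.1 (i.2 : XYPoly K n) := by
    rw [Fintype.linearIndependent_iff]
    -- `f p` collects the part of the relation at the cell `p` into a single operator; it suffices
    -- that every `f p` vanishes.
    intro g hg
    let f : ℕ × ℕ → XYPoly K n := fun p =>
      if hp : p ∈ μ.cells then ∑ b ∈ (hft ⟨p, hp⟩).elems, g ⟨⟨p, hp⟩, b⟩ • (b : XYPoly K n) else 0
    have hf : ∀ p : {p : ℕ × ℕ // p ∈ μ.cells},
        f p.1 = ∑ b : B p.1, g ⟨p, b⟩ • (b : XYPoly K n) := fun p => dif_pos p.2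
    have hfβ : ∀ p : {p : ℕ × ℕ // p ∈ μ.cells}, diffOp (f p.1) (deltaPoly K β hβ) =
        ∑ b : B p.1, g ⟨p, b⟩ • flipBy (deltaPoly K β hβ) (b : XYPoly K n) := by
      intro p
      rw [← flipLin_apply, hf, map_sum]
      simp only [hflip, map_smul]
    have hrel : ∀ d : ℕ × ℕ,
        ∑ p ∈ μ.cells, diffOp (f p) (lastCoeff (d + p) (deltaPoly K μ hμ)) = 0 := by
      intro d
      have h1 := congrArg (lastCoeff d) hg
      rw [map_sum, Fintype.sum_sigma, map_zero] at h1
      rw [← h1, ← Finset.sum_coe_sort μ.cells]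
      refine Finset.sum_congr rfl fun p _ => ?_
      rw [← flipLin_apply, hf, map_sum]
      refine Finset.sum_congr rfl fun b _ => ?_
      rw [map_smul, map_smul, lastCoeff_cellDeriv, flipLin_apply]
    have hmem : ∀ {r s : ℕ} (hp : (r, s) ∈ μ.cells) {W : Submodule K (XYPoly K n)},
        IsBasisOf (fun P : B (r, s) => (P : XYPoly K n)) W → f (r, s) ∈ W := by
      intro r s hp W hW
      let _ : Fintype (B (r, s)) := hft ⟨(r, s), hp⟩
      rw [hf ⟨(r, s), hp⟩]
      exact hW.sum_mem fun b => g ⟨⟨(r, s), hp⟩, b⟩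
    obtain ⟨u, hu, hDA⟩ := exists_lastCoeff_deltaPoly (K := K) hμ hα
      ((hcells _ _).2 (Or.inr ⟨by omega, by omega⟩)) hαμ
    obtain ⟨v, hv, hDB⟩ := exists_lastCoeff_deltaPoly (K := K) hμ hβ
      ((hcells _ _).2 (Or.inl ⟨by omega, by omega⟩)) hβμ
    have hzero := forall_eq_zero_of_cell_relations hla hlb ha hc hcells
      (fun p hp => lastCoeff_deltaPoly_of_notMem (K := K) μ hμ hp) hu hv hDA hDB hrel
      (fun r s h1 h2 h3 => by
        rw [← derivSpan_eq_range]
        exact hmem ((hcells r s).2 (by omega)) (hUPR r s h1 h2 h3))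
      (fun r s h1 h2 h3 => by
        rw [← derivSpan_eq_range, ← derivSpan_eq_range]
        exact hmem ((hcells r s).2 (by omega)) (hINS r s h1 h2 h3))
      (fun r s h1 h2 h3 => by
        rw [← derivSpan_eq_range]
        exact hmem ((hcells r s).2 (by omega)) (hMIDA r s h1 h2 h3))
      (fun r s h1 h2 h3 => by
        rw [← derivSpan_eq_range]
        exact hmem ((hcells r s).2 (by omega)) (hMIDB r s h1 h2 h3))
      (fun r s h1 h2 h3 h4 => by
        have hp : (r, s) ∈ μ.cells := (hcells r s).2 (by omega)
        let _ : Fintype (B (r, s)) := hft ⟨(r, s), hp⟩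
        have hb := hOUT r s h1 h2 h3 h4
        have hfp := hfβ ⟨(r, s), hp⟩
        rw [← derivSpan_eq_range, ← derivSpan_eq_range]
        refine ⟨?_, fun h0 => ?_⟩
        · rw [hfp]
          exact (hb.sum_mem fun b => g ⟨⟨(r, s), hp⟩, b⟩).1
        · rw [hfp] at h0
          rw [hf ⟨(r, s), hp⟩]
          exact Finset.sum_eq_zero fun b _ => by
            rw [Fintype.linearIndependent_iff.1 hb.1 _ h0 b, zero_smul])
    rintro ⟨p, b⟩
    have h0 := hzero p.1 p.2
    rw [hf p] at h0
    exact Fintype.linearIndependent_iff.1 (hind p) _ h0 b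
  have hb := IsBasisOf.of_linearIndependent hlin (fun i => cellDeriv_mem_derivSpan μ hμ _ _)
    (hleμ.trans hcard)
  exact ⟨le_antisymm hleμ (hb.card_eq ▸ hcard), hb⟩

end TwoCorners

theorem theorem4p1 {K : Type*} [Field K] [LinearOrder K] [IsStrictOrderedRing K]
    (n la lb a b c : ℕ) (hla : 0 < la) (hlb : 0 < lb) (ha : 0 < a) (hc : 0 < c) (hb : b = a + c)
    -- `μ` is the two-corner partition of `n + 1` with parts `b` (`lb` times) and `a` (`la` times)
    (μ α β : YoungDiagram) (hμ : μ.card = n + 1) (hα : α.card = n) (hβ : β.card = n)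
    (hμrows : μ.rowLens = List.replicate lb b ++ List.replicate la a)
    -- `α`, `β` arise from `μ` by removing the corner cell at the end of the last row of length
    -- `a`, respectively `b`
    (hαμ : α.cells = μ.cells.erase (lb + la - 1, a - 1))
    (hβμ : β.cells = μ.cells.erase (lb - 1, b - 1))
    (hdimα : Module.finrank K (derivSpan K α hα) = n !)
    (hdimβ : Module.finrank K (derivSpan K β hβ) = n !)
    (hdimαβ : 2 * Module.finrank K ↥(derivSpan K α hα ⊓ derivSpan K β hβ) = n !) :
    Module.finrank K (derivSpan K μ hμ) = (n + 1)! ∧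
    ∀ BA BB BAvB BOut : Set (XYPoly K n),
      IsBasisOf (fun P : BA => (P : XYPoly K n)) (derivSpan K α hα) →
      IsBasisOf (fun P : BB => (P : XYPoly K n)) (derivSpan K β hβ) →
      IsBasisOf (fun P : BAvB => (P : XYPoly K n)) (derivSpan K α hα ⊔ derivSpan K β hβ) →
      IsBasisOf (fun P : BOut => flipBy (deltaPoly K β hβ) (P : XYPoly K n))
        (orthCompl (derivSpan K α hα ⊓ derivSpan K β hβ) ⊓ derivSpan K β hβ) →
      ∀ B : ℕ × ℕ → Set (XYPoly K n),
        (∀ p ∈ regionUPR la lb a, B p = BA) →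
        (∀ p ∈ regionINS lb a c, B p = BAvB) →
        (∀ p ∈ regionMID lb a c, B p = if a < c then BB else BA) →
        (∀ p ∈ regionOUT lb a b c, B p = BOut) →
        IsBasisOf
          (fun i : (p : {p : ℕ × ℕ // p ∈ μ.cells}) × B p.1 =>
            cellDeriv (deltaPoly K μ hμ) i.1.1 (i.2 : XYPoly K n))
          (derivSpan K μ hμ) := by
  subst hb
  have hcells := mem_cells_of_rowLens_two_corners hμrows
  have key := fun B => isBasisOf_cellDeriv_of_two_corners (B := B) hla hlb ha hc hμ hα hβ hcells hαμ
    hβμ hdimα hdimβ hdimαβ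
  constructor
  · obtain ⟨BA, hBA⟩ := exists_isBasisOf (derivSpan K α hα)
    obtain ⟨BB, hBB⟩ := exists_isBasisOf (derivSpan K β hβ)
    obtain ⟨BS, hBS⟩ := exists_isBasisOf (derivSpan K α hα ⊔ derivSpan K β hβ)
    obtain ⟨BO, hBO⟩ := exists_isBasisOf_comp (flipBy (deltaPoly K β hβ))
      (orthCompl (derivSpan K α hα ⊓ derivSpan K β hβ) ⊓ derivSpan K β hβ) (by
        rintro x ⟨-, hx⟩
        rw [derivSpan_eq_range] at hx
        obtain ⟨P, rfl⟩ := hx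
        exact ⟨P, (flipLin_apply _ _).symm⟩)
    -- The dimension formula mentions no bases, so some admissible choice has to be exhibited.
    let B : ℕ × ℕ → Set (XYPoly K n) := fun p =>
      if lb ≤ p.1 then BA else if p.2 < a then (if p.2 < c then BS else BA)
        else if p.2 < c then BB else BO
    refine (key B ?_ ?_ ?_ ?_ ?_).1
    · intro r s h1 h2 h3
      rwa [show B (r, s) = BA from if_pos h1]
    · intro r s h1 h2 h3
      rwa [show B (r, s) = BS by simp [B, not_le.2 h1, h2, h3]]
    · intro r s h1 h2 h3
      rwa [show B (r, s) = BA by simp [B, not_lt.2 h2, h3]]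
    · intro r s h1 h2 h3
      rwa [show B (r, s) = BB by simp [B, not_le.2 h1, not_lt.2 h2, h3]]
    · intro r s h1 h2 h3 h4
      rwa [show B (r, s) = BO by simp [B, not_le.2 h1, not_lt.2 h2, not_lt.2 h3]]
  · intro BA BB BAvB BOut hBA hBB hBAvB hBOut B hUPR hINS hMID hOUT
    refine (key B ?_ ?_ ?_ ?_ ?_).2
    · intro r s h1 h2 h3
      rwa [hUPR (r, s) ⟨h1, h2, h3⟩]
    · intro r s h1 h2 h3
      rwa [hINS (r, s) ⟨h1, by split_ifs <;> assumption⟩]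
    · intro r s h1 h2 h3
      have hac : ¬ a < c := by omega
      rwa [hMID (r, s) ⟨h1, by rw [if_neg hac]; exact ⟨h2, h3⟩⟩, if_neg hac]
    · intro r s h1 h2 h3
      have hac : a < c := by omega
      rwa [hMID (r, s) ⟨h1, by rw [if_pos hac]; exact ⟨h2, h3⟩⟩, if_pos hac]
    · intro r s h1 h2 h3 h4
      rwa [hOUT (r, s) ⟨h1, by split_ifs <;> constructor <;> assumption⟩]
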